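/- All cardinals are infinite; $\omega$ is the first infinite ordinal, $\|X\|$ is the cardinality of $X$, and $\mu^+$ is the cardinal successor of $\mu$. **Strong $\lambda$-systems.** Let $\lambda$ be a regular cardinal and $\kappa$ a cardinal. A *strong $\lambda$-system for $\kappa$* is a sequence $\langle\delta,\bar\lambda,\bar f,J,(A_\zeta:\zeta<\kappa)\rangle$ such that - $\delta$ is a (nonzero) limit ordinal with $\|\delta\|<\lambda$; - $\bar\lambda=\langle\lambda_i:i<\delta\rangle$ is a strictly increasing sequence of regular cardinals; - $\bar f=\langle f_\alpha:\alpha<\lambda\rangle$ is a sequence of pairwise distinct elements of $\prod_{i<\delta}\lambda_i$; - $J$ is an ideal of subsets of $\delta$ containing all bounded subsets of $\delta$; - $\bar f$ is $<_J$-increasing and cofinal in $\prod_{i<\delta}(\lambda_i,<)/J$; that is, $\{i<\delta: f_\alpha(i)\not<f_\beta(i)\}\in J$ for $\alpha<\beta<\lambda$, and for every $g\in\prod_{i<\delta}\lambda_i$ there is $\alpha<\lambda$ with $\{i<\delta: g(i)\not\le f_\alpha(i)\}\in J$; - for every $i<\delta$, $\|\{f_\alpha{\restriction}i:\alpha<\lambda\}\|<\lambda_i$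 (in particular this number is $\le\sup_{j<\delta}\lambda_j$); - $\mathrm{cf}(\delta)\le\kappa$ and $\sup_{i<\delta}\lambda_i\le 2^\kappa$; - the sets $A_\zeta\subseteq\delta$ (for $\zeta<\kappa$) are pairwise disjoint and $A_\zeta\notin J$. **Invariants.** Let $B$ be a Boolean algebra and $0<n\le\omega$. - $s_n^+(B)$ is the supremum of $\|P\|^+$ over all $P\subseteq B$ such that for every $k<n$ (where $k<\omega$) no element of $P$ is below the join of $k+1$ other elements of $P$. - $\mathrm{hd}_n^+(B)$ is the supremum of $\|P\|^+$ over all $P\subseteq B$ that carry a well-ordering $<_1$ such that for every $k<n$ (where $k<\omega$) and all $x_0<_1x_1<_1\dots<_1x_{k+1}$ in $P$ we have $x_0\not\le x_1\vee\dots\vee x_{k+1}$. - $\mathrm{hL}_n^+(B)$ is defined as $\mathrm{hd}_n^+(B)$, but with the requirement for all $x_{k+1}<_1\dots<_1x_1<_1x_0$ in $P$. - $\mathrm{hd}^+(B)=\mathrm{hd}^+_\omega(B)$ and $\mathrm{hL}^+(B)=\mathrm{hL}^+_\omega(B)$. **Theorem.** Suppose that there is a strong $\lambda$-system for $\kappa$,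 and let $0<n<\omega$. Then there is a Boolean algebra $B$ such that $$s_n^+(B)=\|B\|^+=\lambda^+,\qquad \mathrm{hd}_n^+(B)=\mathrm{hL}_n^+(B)=\lambda^+,$$ while $$s_\omega^+(B)\le\lambda,\qquad \mathrm{hd}^+(B)\le\lambda,\qquad \mathrm{hL}^+(B)\le\lambda.$$ -/

import Mathlib

open Cardinal Order

universe u

/-- A weak `lam`-system `⟨δ, (lam_i : i < δ), (f_α : α < lam)⟩`. The ordinals below `δ`, below `lam`
and below `lam_i` are represented by the well-ordered types `δ.ToType`, `lam.ord.ToType` and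
`(lamSeq i).ord.ToType`, so that `f α` is an element of the product of the `lam_i`. -/
structure WeakLambdaSystem (lam : Cardinal.{u}) where
  regular : lam.IsRegular
  δ : Ordinal.{u}
  isLimit : IsSuccLimit δ
  card_lt : δ.card < lam
  lamSeq : δ.ToType → Cardinal.{u}
  lamSeq_strictMono : StrictMono lamSeq
  lamSeq_regular : ∀ i, (lamSeq i).IsRegular
  f : lam.ord.ToType → (i : δ.ToType) → (lamSeq i).ord.ToType
  f_injective : Function.Injective f
  card_restrict_le : ∀ i : δ.ToType,
    #(Set.range fun α : lam.ord.ToType => fun j : Set.Iio i => f α j) ≤ ⨆ j, lamSeq j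

/-- A `lam`-system: a weak `lam`-system with an ideal `J` on `δ` containing the bounded sets, modulo
which the sequence `f` is increasing and cofinal, and such that the number of restrictions of the
`f α` to `i` is less than `lam_i`. -/
structure LambdaSystem (lam : Cardinal.{u}) extends WeakLambdaSystem lam where
  J : Order.Ideal (Set δ.ToType)
  bounded_mem : ∀ i : δ.ToType, Set.Iio i ∈ J
  f_increasing : ∀ α β : lam.ord.ToType, α < β → {i | ¬ f α i < f β i} ∈ J
  f_cofinal : ∀ g : (i : δ.ToType) → (lamSeq i).ord.ToType,
    ∃ α : lam.ord.ToType, {i | ¬ g i ≤ f α i} ∈ J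
  card_restrict_lt : ∀ i : δ.ToType,
    #(Set.range fun α : lam.ord.ToType => fun j : Set.Iio i => f α j) < lamSeq i

/-- A strong `lam`-system for `κ`. -/
structure StrongLambdaSystem (lam κ : Cardinal.{u}) extends LambdaSystem lam where
  cof_le : δ.cof ≤ κ
  sup_le : (⨆ i, lamSeq i) ≤ 2 ^ κ
  A : κ.ord.ToType → Set δ.ToType
  A_notMem : ∀ ζ, A ζ ∉ J
  A_disjoint : ∀ ζ ξ, ζ ≠ ξ → Disjoint (A ζ) (A ξ)

section Invariants

variable (B : Type u) [BooleanAlgebra B]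

/-- A condition on a Boolean algebra with a distinguished subset `P₀` and a binary relation `P₁`. -/
abbrev InvFormula : Type u := Set B → (B → B → Prop) → Prop

/-- The invariant `inv⁺_T(B)`: the supremum of the successors `|P₀|⁺`, over all interpretations
`P₀`, `P₁` for which `(B, P₀, P₁)` is a model of `T`. -/
noncomputable def invPlus (T : Set (InvFormula B)) : Cardinal.{u} :=
  sSup {c | ∃ (P₀ : Set B) (P₁ : B → B → Prop), (∀ φ ∈ T, φ P₀ P₁) ∧ c = succ #P₀}

/-- `φ^s_k`: no member of `P₀` is covered by the union of `k + 1` other members of `P₀`. -/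
def phiS (k : ℕ) : InvFormula B := fun P₀ _ =>
  ∀ x ∈ P₀, ∀ F : Finset B, (∀ y ∈ F, y ∈ P₀ ∧ y ≠ x) → F.card = k + 1 → ¬ x ≤ F.sup id

/-- `P₁` is a (strict) well ordering of `P₀`. -/
def WellOrders : InvFormula B := fun P₀ P₁ =>
  IsWellOrder P₀ (fun x y => P₁ x y)

/-- `φ^hd_k`: `P₁` well orders `P₀`, and if `x₀ <₁ x₁ <₁ … <₁ x_{k+1}` are in `P₀` then
`x₀ ≰ x₁ ∨ … ∨ x_{k+1}`. -/
def phiHd (k : ℕ) : InvFormula B := fun P₀ P₁ =>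
  WellOrders B P₀ P₁ ∧
    ∀ x : Fin (k + 2) → B, (∀ i, x i ∈ P₀) → (∀ i j, i < j → P₁ (x i) (x j)) →
      ¬ x 0 ≤ Finset.univ.sup fun i : Fin (k + 1) => x i.succ

/-- `φ^hL_k`: `P₁` well orders `P₀`, and if `x_{k+1} <₁ … <₁ x₁ <₁ x₀` are in `P₀` then
`x₀ ≰ x₁ ∨ … ∨ x_{k+1}`. -/
def phiHL (k : ℕ) : InvFormula B := fun P₀ P₁ =>
  WellOrders B P₀ P₁ ∧
    ∀ x : Fin (k + 2) → B, (∀ i, x i ∈ P₀) → (∀ i j, i < j → P₁ (x j) (x i)) →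
      ¬ x 0 ≤ Finset.univ.sup fun i : Fin (k + 1) => x i.succ

/-- `s⁺_n(B)` for `0 < n ≤ ω`; the value `n = ⊤` is `n = ω`. -/
noncomputable def sPlus (n : ℕ∞) : Cardinal.{u} :=
  invPlus B {φ | ∃ k : ℕ, (k : ℕ∞) < n ∧ φ = phiS B k}

/-- `hd⁺_n(B)` for `0 < n ≤ ω`; the value `n = ⊤` is `n = ω`. -/
noncomputable def hdnPlus (n : ℕ∞) : Cardinal.{u} :=
  invPlus B {φ | ∃ k : ℕ, (k : ℕ∞) < n ∧ φ = phiHd B k}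

/-- `hL⁺_n(B)` for `0 < n ≤ ω`; the value `n = ⊤` is `n = ω`. -/
noncomputable def hLnPlus (n : ℕ∞) : Cardinal.{u} :=
  invPlus B {φ | ∃ k : ℕ, (k : ℕ∞) < n ∧ φ = phiHL B k}

/-- `hd⁺(B) = hd⁺_ω(B)`. -/
noncomputable def hdPlus : Cardinal.{u} := hdnPlus B ⊤

/-- `hL⁺(B) = hL⁺_ω(B)`. -/
noncomputable def hLPlus : Cardinal.{u} := hLnPlus B ⊤

end Invariants

/-! The algebra has generators x_γ (γ < λ) and consists of sets of points (α, w), where w is a set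
of at most n ordinals omitting α. The point (α, w) lies in x_α and in no x_β with β in w, so no
generator is below a join of at most n others; this gives the lower bounds. For every other γ,
membership is the colour of γ, in a colouring of the tree of restrictions, at the level where f_γ
has split from all f_β with β in {α} ∪ w (`val`).

For the upper bounds, λ many elements may be taken to be the same Boolean combination of m
generators, and it suffices to cover conjunctions of literals of one type t. The colouring
(`exists_coloring`) gives λ many tuples the colours t on a single A_ζ above a fixed level.
Cofinality modulo J yields a fan branching at one such level (`exists_fan`). A point in one
conjunction of the fan lies in every other one unless one of its at most n + 1 branches follows that
member through the branching level. Each pair (coordinate, branch) spoils at most one member, so in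
a large fan the others cover each member (`exists_covering_finset`). This works along any linear
order (`exists_le_sup`), hence for s, hd and hL at once. -/

/-! ### Cardinal arithmetic and combinatorial tools -/

theorem card_iUnion_lt_of_finite {c : Cardinal.{u}} (hc : c.IsRegular) {ι : Type} [Finite ι]
    {X : Type u} (t : ι → Set X) (ht : ∀ i, #(t i) < c) : #(⋃ i, t i : Set X) < c := by
  have h := (Cardinal.card_iUnion_lt_iff_forall_of_isRegular (ι := ULift.{u} ι)
    (t := fun i => t i.down) hc (lt_of_lt_of_le (lt_aleph0_of_finite _) hc.aleph0_le)).2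
    fun i => ht i.down
  rwa [show ⋃ i : ULift.{u} ι, t i.down = ⋃ i, t i from
    Equiv.ulift.surjective.iUnion_comp t] at h

theorem Cardinal.IsRegular.exists_le_card_fiber {c : Cardinal.{u}} (hc : c.IsRegular) {I V : Type u}
    (g : I → V) (hI : c ≤ #I) (hV : #V < c) : ∃ v, c ≤ #(g ⁻¹' {v}) :=
  Cardinal.infinite_pigeonhole_card g c hI hc.aleph0_le (by rwa [hc.cof_ord])

theorem Cardinal.IsRegular.exists_forall_lt {c : Cardinal.{u}} (hc : c.IsRegular) (s : Set c.ord.ToType)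
    (hs : #s < c) : ∃ b, ∀ x ∈ s, x < b := by
  have h : ¬ IsCofinal s := fun h => by
    have := Order.cof_le h
    rw [Ordinal.cof_toType, hc.cof_ord] at this
    exact this.not_gt hs
  simpa [IsCofinal] using h

/-- Any `lam` many finite tuples of ordinals below `lam` can be thinned out so that each coordinate
is constant or has all its fibers of size less than `lam`. -/
theorem exists_thinning {lam : Cardinal.{u}} {I V : Type u} {m : ℕ} (a : I → Fin m → V)
    (hI : lam ≤ #I) : ∃ Y : Set I, lam ≤ #Y ∧ ∀ k, (∀ ξ ∈ Y, ∀ ξ' ∈ Y, a ξ k = a ξ' k) ∨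
      ∀ v, #{ξ | ξ ∈ Y ∧ a ξ k = v} < lam := by
  suffices ∀ s : Finset (Fin m), ∃ Y : Set I, lam ≤ #Y ∧ ∀ k ∈ s,
      (∀ ξ ∈ Y, ∀ ξ' ∈ Y, a ξ k = a ξ' k) ∨ ∀ v, #{ξ | ξ ∈ Y ∧ a ξ k = v} < lam by
    simpa using this Finset.univ
  intro s
  induction s using Finset.induction_on with
  | empty => exact ⟨Set.univ, by simpa using hI, by simp⟩
  | insert k s _ ih =>
    obtain ⟨Y, hY, h⟩ := ih
    -- A large fiber can replace `Y`: both alternatives for earlier coordinates survive shrinking.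
    by_cases hk : ∃ v, lam ≤ #{ξ | ξ ∈ Y ∧ a ξ k = v}
    · obtain ⟨v, hv⟩ := hk
      refine ⟨_, hv, fun l hl => ?_⟩
      rcases Finset.mem_insert.1 hl with rfl | hl
      · exact Or.inl fun ξ hξ ξ' hξ' => hξ.2.trans hξ'.2.symm
      · refine (h l hl).imp (fun H ξ hξ ξ' hξ' => H ξ hξ.1 ξ' hξ'.1) fun H w => ?_
        refine (mk_le_mk_of_subset ?_).trans_lt (H w)
        exact fun ξ hξ => ⟨hξ.1.1, hξ.2⟩
    · push Not at hk
      refine ⟨Y, hY, fun l hl => ?_⟩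
      rcases Finset.mem_insert.1 hl with rfl | hl
      · exact Or.inr hk
      · exact h l hl

theorem card_le_lt_of_fibers {c : Cardinal.{u}} (hc : c.IsRegular) {I : Type u} (Y : Set I)
    (g : I → c.ord.ToType) (h : ∀ v, #{ξ | ξ ∈ Y ∧ g ξ = v} < c) (b : c.ord.ToType) :
    #{ξ | ξ ∈ Y ∧ g ξ ≤ b} < c := by
  have hb : #(Set.Iic b) < c := by
    rw [← Set.Iio_insert]
    exact mk_insert_le.trans_lt (add_lt_of_lt hc.aleph0_le
      (by simpa using mk_Iio_lt b (by simp))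
      (one_lt_aleph0.trans_le hc.aleph0_le))
  refine (mk_le_mk_of_subset ?_).trans_lt ((card_biUnion_lt_iff_forall_of_isRegular
    (t := fun v (_ : v ∈ Set.Iic b) => {ξ | ξ ∈ Y ∧ g ξ = v}) hc hb).2 fun v _ => h v)
  intro ξ hξ
  simpa using hξ

/-- On a set of size at most `2 ^ κ` there are `κ` many predicates, indexed by
`Finset κ × Finset (Finset κ)`, that realize every finite pattern. -/
theorem exists_dense_predicates {X K : Type u} (h : #X ≤ 2 ^ #K) :
    ∃ d : Finset K × Finset (Finset K) → X → Prop, ∀ (m : ℕ) (x : Fin m → X),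
      Function.Injective x → ∀ t : Fin m → Prop, ∃ z, ∀ k, d z (x k) ↔ t k := by
  classical
  rw [← mk_set] at h
  obtain ⟨e⟩ := h
  -- Points are coded by subsets of `K`; the predicate `z` tests whether the trace of the code on
  -- `z.1` belongs to the list `z.2`.
  refine ⟨fun z x => z.1.filter (· ∈ e x) ∈ z.2, fun m x hx t => ?_⟩
  have sep : ∀ p : Fin m × Fin m, ∃ u : Finset K,
      (∀ y ∈ u, y ∈ e (x p.1) ↔ y ∈ e (x p.2)) → p.1 = p.2 := by
    intro p
    by_cases hp : p.1 = p.2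
    · exact ⟨∅, fun _ => hp⟩
    · have : e (x p.1) ≠ e (x p.2) := fun h => hp (hx (e.injective h))
      rw [Ne, Set.ext_iff, not_forall] at this
      obtain ⟨y, hy⟩ := this
      exact ⟨{y}, fun h => absurd (h y (by simp)) hy⟩
  choose u hu using sep
  refine ⟨⟨Finset.univ.biUnion u, (Finset.univ.filter t).image fun k =>
    (Finset.univ.biUnion u).filter (· ∈ e (x k))⟩, fun k => ?_⟩
  simp only [Finset.mem_image, Finset.mem_filter, Finset.mem_univ, true_and]
  refine ⟨fun ⟨l, hl, h⟩ => ?_, fun h => ⟨k, h, rfl⟩⟩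
  have : l = k := hu (l, k) fun y hy => by
    have := Finset.ext_iff.1 h y
    simpa [show ∃ a b, y ∈ u (a, b) from ⟨l, k, hy⟩] using this
  exact this ▸ hl

theorem card_fin_fun_lt {c : Cardinal.{u}} (hc : c.IsRegular) {X : Type u} (hX : #X < c) (m : ℕ) :
    #(Fin m → X) < c := by
  have h : #(Fin m → X) = #X ^ m := by simp
  rw [h]
  rcases lt_or_ge #X ℵ₀ with h | h
  · exact (power_lt_aleph0 h (natCast_lt_aleph0)).trans_le hc.aleph0_le
  · exact (power_nat_le h).trans_lt hX

/-- If the coordinates in `R` of the tuples `g ξ`, `ξ ∈ Y`, are simultaneously unbounded, there are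
arbitrarily many `ξ ∈ Y` such that the values at each coordinate in `R` are pairwise distinct. -/
theorem exists_finset_of_unbounded {I V : Type u} [LinearOrder V] [Nonempty V] {m : ℕ}
    (g : I → Fin m → V) (Y : Set I) (R : Finset (Fin m)) (hR : R.Nonempty)
    (h : ∀ b, ∃ ξ ∈ Y, ∀ k ∈ R, b < g ξ k) (N : ℕ) :
    ∃ W : Finset I, W.card = N ∧ (∀ ξ ∈ W, ξ ∈ Y) ∧
      ∀ k ∈ R, ∀ ξ ∈ W, ∀ ξ' ∈ W, ξ ≠ ξ' → g ξ k ≠ g ξ' k := by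
  classical
  induction N with
  | zero => exact ⟨∅, by simp⟩
  | succ N ih =>
    obtain ⟨W, hW, hWY, hd⟩ := ih
    obtain ⟨k₀, hk₀⟩ := hR
    -- A tuple exceeding all values used so far is new at every coordinate in `R`.
    obtain ⟨b, hb⟩ := ((W ×ˢ R).image fun p => g p.1 p.2).bddAbove
    obtain ⟨ξ, hξ, hbξ⟩ := h b
    have hlt : ∀ k ∈ R, ∀ ξ' ∈ W, g ξ' k < g ξ k := fun k hk ξ' hξ' =>
      (hb (Finset.mem_coe.2 (Finset.mem_image.2 ⟨(ξ', k), by simp [hξ', hk], rfl⟩))).trans_lt (hbξ k hk)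
    have hξW : ξ ∉ W := fun hmem => (hlt k₀ hk₀ ξ hmem).false
    refine ⟨insert ξ W, by simp [hW, hξW], by simpa using ⟨hξ, hWY⟩, fun k hk => ?_⟩
    intro x hx y hy hxy
    rcases Finset.mem_insert.1 hx with rfl | hx' <;> rcases Finset.mem_insert.1 hy with rfl | hy'
    · exact absurd rfl hxy
    · exact (hlt k hk y hy').ne'
    · exact (hlt k hk x hx').ne
    · exact hd k hk x hx' y hy' hxy

/-! ### Colouring the tree of restrictions -/

namespace StrongLambdaSystem

variable {lam κ : Cardinal.{u}} (S : StrongLambdaSystem lam κ)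

theorem A_nonempty (ζ : κ.ord.ToType) : (S.A ζ).Nonempty := by
  rw [Set.nonempty_iff_ne_empty]
  exact fun h => S.A_notMem ζ (h ▸ S.J.bot_mem)

theorem card_index_lt : #S.δ.ToType < lam := by
  rw [mk_toType]
  exact S.card_lt

theorem le_card_index : κ ≤ #S.δ.ToType := by
  choose i hi using S.A_nonempty
  have : Function.Injective i := fun ζ ξ h => by
    by_contra hne
    exact Set.disjoint_left.1 (S.A_disjoint ζ ξ hne) (hi ζ) (h ▸ hi ξ)
  simpa using mk_le_of_injective this

theorem aleph0_le_kappa (S : StrongLambdaSystem lam κ) : ℵ₀ ≤ κ :=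
  (Ordinal.aleph0_le_cof_iff.2 (Ordinal.one_lt_cof_iff.2 S.isLimit)).trans S.cof_le

theorem aleph0_lt (S : StrongLambdaSystem lam κ) : ℵ₀ < lam :=
  S.aleph0_le_kappa.trans_lt (S.le_card_index.trans_lt S.card_index_lt)

theorem nonempty_index : Nonempty S.δ.ToType := by
  rw [← mk_ne_zero_iff]
  exact (aleph0_pos.trans_le (S.aleph0_le_kappa.trans S.le_card_index)).ne'

theorem noMaxOrder_index : NoMaxOrder S.δ.ToType := by
  have := S.nonempty_index
  have : NoTopOrder S.δ.ToType := by
    rw [← one_lt_cof_iff, Ordinal.cof_toType]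
    exact Ordinal.one_lt_cof_iff.2 S.isLimit
  exact ⟨fun a => (exists_not_le a).imp fun _ => lt_of_not_ge⟩

/-- The restriction of `f α` to the indices below `i`. -/
def restr (i : S.δ.ToType) (α : lam.ord.ToType) :
    Set.range fun α : lam.ord.ToType => fun j : Set.Iio i => S.f α j :=
  ⟨fun j => S.f α j, α, rfl⟩

theorem restr_eq_iff {i : S.δ.ToType} {α β : lam.ord.ToType} :
    S.restr i α = S.restr i β ↔ ∀ j < i, S.f α j = S.f β j := by
  rw [Subtype.ext_iff, restr, restr, funext_iff, Subtype.forall]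
  rfl

/-- A colouring of the nodes of the tree of restrictions of the `f α` such that every finite pattern
is realized on all large levels in some `A ζ`. -/
theorem exists_coloring : ∃ col : S.δ.ToType → lam.ord.ToType → Prop,
    (∀ i α β, (∀ j < i, S.f α j = S.f β j) → (col i α ↔ col i β)) ∧
    ∀ (m : ℕ) (a : Fin m → lam.ord.ToType), Function.Injective a → ∀ t : Fin m → Prop,
      ∃ ζ i₀, ∀ i ∈ S.A ζ, i₀ ≤ i → ∀ k, col i (a k) ↔ t k := by
  classical
  obtain ⟨C, hC, hCc⟩ := exists_cof_eq (α := S.δ.ToType)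
  have := S.nonempty_index
  have := S.noMaxOrder_index
  let K := κ.ord.ToType
  have hK : #K = κ := mk_ord_toType κ
  have : Infinite K := infinite_iff.2 (hK ▸ S.aleph0_le_kappa)
  have hX : ∀ i : S.δ.ToType,
      #(Set.range fun α : lam.ord.ToType => fun j : Set.Iio i => S.f α j) ≤ 2 ^ #K := fun i => by
    rw [hK]
    exact (S.card_restrict_lt i).le.trans ((le_ciSup bddAbove_of_small i).trans S.sup_le)
  choose d hd using fun i => exists_dense_predicates (hX i)
  have hZ : #(C × Finset K × Finset (Finset K)) ≤ #K := by
    have hCK : #C ≤ #K := by rw [hCc, Ordinal.cof_toType, hK]; exact S.cof_le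
    simp only [mk_prod, lift_id, mk_finset_of_infinite]
    exact mul_le_of_le (aleph0_le_mk K) hCK (mul_le_of_le (aleph0_le_mk K) le_rfl le_rfl)
  obtain ⟨ι⟩ := hZ
  -- Each set `A (ι z)` carries one instruction `z`: a level of a cofinal set `C`, and a predicate
  -- applied to the restriction to that level.
  refine ⟨fun i α => ∃ z : C × Finset K × Finset (Finset K), i ∈ S.A (ι z) ∧ z.1 ≤ i ∧
    d z.1 z.2 (S.restr z.1 α), fun i α β h => ?_, fun m a ha t => ?_⟩
  · refine exists_congr fun z => and_congr_right fun _ => and_congr_right fun hz => ?_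
    rw [S.restr_eq_iff.2 fun j hj => h j (hj.trans_le hz)]
  · have hsep : ∀ p : Fin m × Fin m, ∃ j, p.1 ≠ p.2 → S.f (a p.1) j ≠ S.f (a p.2) j := by
      intro p
      by_cases hp : p.1 = p.2
      · exact ⟨Classical.arbitrary _, fun h => absurd hp h⟩
      · obtain ⟨j, hj⟩ := Function.ne_iff.1 (S.f_injective.ne (ha.ne hp))
        exact ⟨j, fun _ => hj⟩
    choose j hj using hsep
    -- Above all separating levels, the restrictions of the `a k` are pairwise distinct.
    obtain ⟨M, hM⟩ := (Set.finite_range j).bddAbove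
    obtain ⟨M', hM'⟩ := exists_gt M
    obtain ⟨c, hc, hMc⟩ := hC M'
    have hinj : Function.Injective fun k => S.restr c (a k) := fun k l h => by
      by_contra hne
      exact hj (k, l) hne (S.restr_eq_iff.1 h _
        ((hM (Set.mem_range_self (k, l))).trans_lt (hM'.trans_le hMc)))
    obtain ⟨z, hz⟩ := hd c m _ hinj t
    refine ⟨ι (⟨c, hc⟩, z), c, fun i hi hci k => ⟨?_, fun h => ⟨(⟨c, hc⟩, z), hi, hci, (hz k).2 h⟩⟩⟩
    rintro ⟨z', hi', -, h⟩
    have hzz : ι z' = ι (⟨c, hc⟩, z) := by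
      by_contra hne
      exact Set.disjoint_left.1 (S.A_disjoint _ _ hne) hi' hi
    obtain rfl := ι.injective hzz
    exact (hz k).1 h

end StrongLambdaSystem

/-! ### Fans branching at a common level -/

namespace StrongLambdaSystem

variable {lam κ : Cardinal.{u}} (S : StrongLambdaSystem lam κ)

theorem nonempty_level (i : S.δ.ToType) : Nonempty (S.lamSeq i).ord.ToType := by
  rw [← mk_ne_zero_iff, mk_ord_toType]
  exact (S.lamSeq_regular i).ne_zero

theorem iUnion_mem_J {ι : Type*} (s : Finset ι) (t : ι → Set S.δ.ToType) (h : ∀ k ∈ s, t k ∈ S.J) :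
    (⋃ k ∈ s, t k) ∈ S.J := by
  classical
  induction s using Finset.induction_on with
  | empty => simpa using S.J.bot_mem
  | insert k s _ ih =>
    rw [Finset.set_biUnion_insert]
    exact S.J.sup_mem (h k (by simp)) (ih fun l hl => h l (by simp [hl]))

/-- If every tuple `a ξ`, `ξ ∈ Y`, has a coordinate in `R` whose value at level `i` is bounded in
terms of `i` and its restrictions to `i` only, then it has one bounded in terms of `i` only. -/
theorem exists_bound {I : Type u} {m : ℕ} (a : I → Fin m → lam.ord.ToType) (Y : Set I)
    (R : Finset (Fin m)) (i : S.δ.ToType)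
    (h : ∀ η, ∃ b, ∀ ξ ∈ Y, (fun k => S.restr i (a ξ k)) = η → ∃ k ∈ R, S.f (a ξ k) i ≤ b) :
    ∃ b, ∀ ξ ∈ Y, ∃ k ∈ R, S.f (a ξ k) i ≤ b := by
  choose b hb using h
  -- Fewer than λ_i restrictions occur, so by regularity their bounds have a common bound.
  obtain ⟨b', hb'⟩ := (S.lamSeq_regular i).exists_forall_lt (Set.range b)
    (mk_range_le.trans_lt (card_fin_fun_lt (S.lamSeq_regular i) (S.card_restrict_lt i) m))
  refine ⟨b', fun ξ hξ => ?_⟩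
  obtain ⟨k, hk, h⟩ := hb _ ξ hξ rfl
  exact ⟨k, hk, h.trans (hb' _ ⟨_, rfl⟩).le⟩

/-- Among `lam` many tuples there are arbitrarily many that branch on a common level in `A ζ`: there,
each coordinate is constant, or has constant restriction and pairwise distinct values. -/
theorem exists_fan {I : Type u} {m : ℕ} (a : I → Fin m → lam.ord.ToType) (hI : lam ≤ #I)
    (ζ : κ.ord.ToType) (i₀ : S.δ.ToType) (N : ℕ) :
    ∃ i ∈ S.A ζ, i₀ ≤ i ∧ ∃ W : Finset I, W.card = N ∧ ∀ k,
      (∀ ξ ∈ W, ∀ ξ' ∈ W, a ξ k = a ξ' k) ∨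
      ((∀ ξ ∈ W, ∀ ξ' ∈ W, ∀ j < i, S.f (a ξ k) j = S.f (a ξ' k) j) ∧
        ∀ ξ ∈ W, ∀ ξ' ∈ W, ξ ≠ ξ' → S.f (a ξ k) i ≠ S.f (a ξ' k) i) := by
  classical
  obtain ⟨Y, hY, hYk⟩ := exists_thinning a hI
  have not_subset : ∀ s ∈ S.J, ∃ i ∈ S.A ζ, i₀ ≤ i ∧ i ∉ s := fun s hs => by
    by_contra! h
    refine S.A_notMem ζ (S.J.lower ?_ (S.J.sup_mem hs (S.bounded_mem i₀)))
    intro i hi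
    by_cases hi₀ : i₀ ≤ i
    · exact Or.inl (h i hi hi₀)
    · exact Or.inr (lt_of_not_ge hi₀)
  let R : Finset (Fin m) := Finset.univ.filter fun k => ¬ ∀ ξ ∈ Y, ∀ ξ' ∈ Y, a ξ k = a ξ' k
  have hRmem : ∀ k, k ∈ R ↔ ¬ ∀ ξ ∈ Y, ∀ ξ' ∈ Y, a ξ k = a ξ' k := fun k => by simp [R]
  rcases R.eq_empty_or_nonempty with hR | hR
  · obtain ⟨i, hi, hi₀, -⟩ := not_subset ∅ S.J.bot_mem
    have hYinf : Y.Infinite := by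
      rw [← Set.infinite_coe_iff, infinite_iff]
      exact S.regular.aleph0_le.trans hY
    obtain ⟨W, hWY, hW⟩ := hYinf.exists_subset_card_eq N
    refine ⟨i, hi, hi₀, W, hW, fun k => Or.inl fun ξ hξ ξ' hξ' => ?_⟩
    have := (hRmem k).not.1 (by simp [hR])
    push Not at this
    exact this ξ (hWY hξ) ξ' (hWY hξ')
  -- Simultaneous unboundedness over one fixed node tuple `η` allows the fan to be picked greedily.
  by_cases key : ∃ i ∈ S.A ζ, i₀ ≤ i ∧ ∃ η : Fin m → _, ∀ b, ∃ ξ ∈ Y,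
      (fun k => S.restr i (a ξ k)) = η ∧ ∀ k ∈ R, b < S.f (a ξ k) i
  · obtain ⟨i, hi, hi₀, η, h⟩ := key
    have := S.nonempty_level i
    obtain ⟨W, hW, hWY, hd⟩ := exists_finset_of_unbounded (fun ξ k => S.f (a ξ k) i)
      {ξ | ξ ∈ Y ∧ (fun k => S.restr i (a ξ k)) = η} R hR (fun b => by
        obtain ⟨ξ, h₁, h₂, h₃⟩ := h b
        exact ⟨ξ, ⟨h₁, h₂⟩, h₃⟩) N
    refine ⟨i, hi, hi₀, W, hW, fun k => ?_⟩
    by_cases hk : k ∈ R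
    · refine Or.inr ⟨fun ξ hξ ξ' hξ' => S.restr_eq_iff.1 ?_, hd k hk⟩
      exact (congr_fun (hWY ξ hξ).2 k).trans (congr_fun (hWY ξ' hξ').2 k).symm
    · rw [hRmem, not_not] at hk
      exact Or.inl fun ξ hξ ξ' hξ' => hk ξ (hWY ξ hξ).1 ξ' (hWY ξ' hξ').1
  · exfalso
    push Not at key
    -- Otherwise the bounds form a function `g`. Some f_α dominates `g` modulo J, and some tuple has
    -- all its coordinates in `R` above α, so it beats `g` at a level of `A ζ`, a contradiction.
    have hg : ∀ i, ∃ b, i ∈ S.A ζ → i₀ ≤ i → ∀ ξ ∈ Y, ∃ k ∈ R, S.f (a ξ k) i ≤ b := fun i => by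
      by_cases hi : i ∈ S.A ζ ∧ i₀ ≤ i
      · obtain ⟨b, hb⟩ := S.exists_bound a Y R i (key i hi.1 hi.2)
        exact ⟨b, fun _ _ => hb⟩
      · exact ⟨(S.nonempty_level i).some, fun h₁ h₂ => absurd ⟨h₁, h₂⟩ hi⟩
    choose g hg using hg
    obtain ⟨α, hα⟩ := S.f_cofinal g
    have hsmall : #(⋃ k, if k ∈ R then {ξ | ξ ∈ Y ∧ a ξ k ≤ α} else ∅ : Set I) < lam := by
      refine card_iUnion_lt_of_finite S.regular _ fun k => ?_
      split_ifs with hk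
      · exact card_le_lt_of_fibers S.regular Y _ ((hYk k).resolve_left ((hRmem k).1 hk)) α
      · simpa using S.regular.pos
    obtain ⟨ξ, hξ, hξα⟩ : ∃ ξ ∈ Y, ∀ k ∈ R, α < a ξ k := by
      by_contra! h
      refine ((mk_le_mk_of_subset ?_).trans_lt hsmall).not_ge hY
      intro ξ hξ
      obtain ⟨k, hk, h⟩ := h ξ hξ
      exact Set.mem_iUnion.2 ⟨k, by simpa [hk] using ⟨hξ, h⟩⟩
    obtain ⟨i, hi, hi₀, his⟩ := not_subset _ (S.J.sup_mem hα
      (S.iUnion_mem_J R _ fun k hk => S.f_increasing α (a ξ k) (hξα k hk)))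
    obtain ⟨k, hk, h⟩ := hg i hi hi₀ ξ hξ
    simp only [Set.sup_eq_union, Set.mem_union, not_or, Set.mem_iUnion, Set.mem_ofPred_eq, not_not,
      not_exists] at his
    exact (his.1.trans_lt (his.2 k hk)).not_ge h

end StrongLambdaSystem

/-! ### Generated algebras of sets and normal forms -/

section Generated

variable {X Pt : Type u} (val : Pt → X → Prop)

/-- The algebra of sets of points generated by the sets on which a given coordinate holds. -/
abbrev coordAlgebra : BooleanSubalgebra (Set Pt) :=
  BooleanSubalgebra.closure (Set.range fun x => {p | val p x})

/-- The generator of `coordAlgebra` belonging to the coordinate `x`. -/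
def coordGen (x : X) : coordAlgebra val :=
  ⟨{p | val p x}, BooleanSubalgebra.subset_closure ⟨x, rfl⟩⟩

theorem exists_finset_support (b : coordAlgebra val) : ∃ s : Finset X, ∀ p q,
    (∀ x ∈ s, val p x ↔ val q x) → (p ∈ b.1 ↔ q ∈ b.1) := by
  classical
  obtain ⟨b, hb⟩ := b
  induction hb using BooleanSubalgebra.closure_bot_sup_induction with
  | mem b hb =>
    obtain ⟨x, rfl⟩ := hb
    exact ⟨{x}, fun p q h => h x (by simp)⟩
  | bot => exact ⟨∅, fun p q _ => Iff.rfl⟩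
  | sup b hb c hc ihb ihc =>
    obtain ⟨s, hs⟩ := ihb
    obtain ⟨t, ht⟩ := ihc
    exact ⟨s ∪ t, fun p q h => or_congr (hs p q fun x hx => h x (Finset.mem_union_left _ hx))
      (ht p q fun x hx => h x (Finset.mem_union_right _ hx))⟩
  | compl b hb ih =>
    obtain ⟨s, hs⟩ := ih
    exact ⟨s, fun p q h => not_congr (hs p q h)⟩

theorem exists_normal_form (b : coordAlgebra val) : ∃ (c : Σ m, Set (Fin m → Prop))
    (a : Fin c.1 → X), Function.Injective a ∧ ∀ p, p ∈ b.1 ↔ (fun k => val p (a k)) ∈ c.2 := by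
  obtain ⟨s, hs⟩ := exists_finset_support val b
  refine ⟨⟨s.card, {t | ∃ p ∈ b.1, (fun k => val p (s.equivFin.symm k)) = t}⟩,
    fun k => s.equivFin.symm k, Subtype.val_injective.comp s.equivFin.symm.injective, fun p => ?_⟩
  refine ⟨fun hp => ⟨p, hp, rfl⟩, fun ⟨q, hq, h⟩ => (hs q p fun x hx => ?_).1 hq⟩
  have := congr_fun h (s.equivFin ⟨x, hx⟩)
  simpa using this

/-- An element is determined by a finite support together with the finite family of traces of its
points on that support. -/
theorem mk_coordAlgebra_le [Infinite X] : #(coordAlgebra val) ≤ #X := by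
  classical
  choose s hs using exists_finset_support val
  have hfin : ∀ b : coordAlgebra val, {u | ∃ p ∈ b.1, u = (s b).filter (val p)}.Finite := fun b =>
    (s b).powerset.finite_toSet.subset (by
      rintro _ ⟨p, -, rfl⟩
      exact Finset.mem_coe.2 (Finset.mem_powerset.2 (Finset.filter_subset _ _)))
  have hinj : Function.Injective fun b => (s b, (hfin b).toFinset) := by
    intro b c h
    obtain ⟨h₁, h₂⟩ := Prod.mk.inj h
    have key : ∀ b c : coordAlgebra val, s b = s c → (hfin b).toFinset = (hfin c).toFinset →
        b.1 ⊆ c.1 := fun b c h₁ h₂ p hp => by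
      have : (s b).filter (val p) ∈ (hfin c).toFinset := by
        rw [← h₂, Set.Finite.mem_toFinset]
        exact ⟨p, hp, rfl⟩
      rw [Set.Finite.mem_toFinset] at this
      obtain ⟨q, hq, h⟩ := this
      refine (hs c q p fun x hx => ?_).1 hq
      have := Finset.ext_iff.1 h x
      simp only [Finset.mem_filter, h₁, hx, true_and] at this
      exact this.symm
    exact Subtype.ext ((key b c h₁ h₂).antisymm (key c b h₁.symm h₂.symm))
  have := mk_le_of_injective hinj
  simpa [mk_prod, mk_finset_of_infinite] using this

theorem mem_finset_sup_coordAlgebra {ι : Type*} (s : Finset ι) (b : ι → coordAlgebra val) (p : Pt) :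
    p ∈ (s.sup b).1 ↔ ∃ i ∈ s, p ∈ (b i).1 := by
  classical
  induction s using Finset.induction_on with
  | empty => simp
  | insert i s _ ih => simp [ih]

end Generated

/-! ### Points and the values of generators -/

namespace StrongLambdaSystem

variable {lam κ : Cardinal.{u}} (S : StrongLambdaSystem lam κ)

/-- Points `(α, w)` at which the generator of `α` will hold and those of the members of `w` fail. -/
def Point (lam : Cardinal.{u}) (n : ℕ) : Type u :=
  {p : lam.ord.ToType × Finset lam.ord.ToType // p.1 ∉ p.2 ∧ p.2.card ≤ n}

/-- The value of the generator of `γ` at `(α, w)`: it holds if `γ = α`, and otherwise it is given by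
the colour of `γ` at the level where `γ` has split from all of `α` and `w`. -/
def val (col : S.δ.ToType → lam.ord.ToType → Prop) {n : ℕ} (p : Point lam n)
    (γ : lam.ord.ToType) : Prop :=
  γ = p.1.1 ∨ ∃ i, IsLeast {i | ∀ β, β = p.1.1 ∨ β ∈ p.1.2 → ∃ j ≤ i, S.f γ j ≠ S.f β j} i ∧ col i γ

variable {S} {col : S.δ.ToType → lam.ord.ToType → Prop}

theorem val_self {n : ℕ} (p : Point lam n) : S.val col p p.1.1 := Or.inl rfl

theorem not_val_of_mem {n : ℕ} (p : Point lam n) {β : lam.ord.ToType} (hβ : β ∈ p.1.2) :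
    ¬ S.val col p β := by
  rintro (rfl | ⟨i, hi, -⟩)
  · exact p.2.1 hβ
  · obtain ⟨j, -, hj⟩ := hi.1 β (Or.inr hβ)
    exact hj rfl

/-- The value at `γ` is the colour at level `i` if `i` is the level at which `γ` has split. -/
theorem val_iff_of_isLeast {n : ℕ} {p : Point lam n} {γ : lam.ord.ToType} {i : S.δ.ToType}
    (hi : IsLeast {i | ∀ β, β = p.1.1 ∨ β ∈ p.1.2 → ∃ j ≤ i, S.f γ j ≠ S.f β j} i) :
    S.val col p γ ↔ col i γ := by
  refine ⟨?_, fun h => Or.inr ⟨i, hi, h⟩⟩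
  rintro (rfl | ⟨i', hi', h⟩)
  · obtain ⟨j, -, hj⟩ := hi.1 _ (Or.inl rfl)
    exact absurd rfl hj
  · rwa [hi.unique hi']

/-- Only finitely many β are involved, so the maximum of chosen levels of difference is a splitting
level below `i`. -/
theorem exists_isLeast_split {n : ℕ} (p : Point lam n) (γ : lam.ord.ToType) (i : S.δ.ToType)
    (h : ∀ β, β = p.1.1 ∨ β ∈ p.1.2 → ∃ j < i, S.f γ j ≠ S.f β j) :
    ∃ l < i, IsLeast {l | ∀ β, β = p.1.1 ∨ β ∈ p.1.2 → ∃ j ≤ l, S.f γ j ≠ S.f β j} l := by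
  classical
  have hj : ∀ β, ∃ j, β = p.1.1 ∨ β ∈ p.1.2 → j < i ∧ S.f γ j ≠ S.f β j := fun β => by
    by_cases hβ : β = p.1.1 ∨ β ∈ p.1.2
    · exact (h β hβ).imp fun j hj _ => hj
    · exact ⟨i, fun h => absurd h hβ⟩
  choose j hj using hj
  obtain ⟨β₀, hβ₀, hmax⟩ := (insert p.1.1 p.1.2).exists_max_image j ⟨_, Finset.mem_insert_self _ _⟩
  have hmem : j β₀ ∈ {l | ∀ β, β = p.1.1 ∨ β ∈ p.1.2 → ∃ j ≤ l, S.f γ j ≠ S.f β j} :=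
    fun β hβ => ⟨j β, hmax β (Finset.mem_insert.2 hβ), (hj β hβ).2⟩
  obtain ⟨l, hl, hmin⟩ := wellFounded_lt.has_min _ ⟨_, hmem⟩
  exact ⟨l, (le_of_not_gt (hmin _ hmem)).trans_lt (hj β₀ (Finset.mem_insert.1 hβ₀)).1, hl,
    fun x hx => le_of_not_gt (hmin x hx)⟩

/-- Let `γ` and `γ'` have the same restriction to `i`, let `γ'` have split from `p` at level `i`, and
let both have the colour `t` at `i`. Then the value `t` at `γ` is inherited by `γ'`. -/
theorem val_of_branch (hcol : ∀ i α β, (∀ j < i, S.f α j = S.f β j) → (col i α ↔ col i β))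
    {n : ℕ} {p : Point lam n} {γ γ' : lam.ord.ToType} {i : S.δ.ToType} {t : Prop}
    (hr : ∀ j < i, S.f γ j = S.f γ' j) (ht' : col i γ' ↔ t)
    (hs : ∀ β, β = p.1.1 ∨ β ∈ p.1.2 → ∃ j ≤ i, S.f γ' j ≠ S.f β j) (hv : S.val col p γ ↔ t) :
    S.val col p γ' ↔ t := by
  by_cases h : ∀ β, β = p.1.1 ∨ β ∈ p.1.2 → ∃ j < i, S.f γ' j ≠ S.f β j
  · obtain ⟨l, hli, hl⟩ := exists_isLeast_split p γ' i h
    -- Below `i` the branches of `γ` and `γ'` agree, so both split at the same level `l` and have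
    -- the same colour there.
    have hl' : IsLeast {l | ∀ β, β = p.1.1 ∨ β ∈ p.1.2 → ∃ j ≤ l, S.f γ j ≠ S.f β j} l := by
      refine ⟨fun β hβ => ?_, fun l' hl' => le_of_not_gt fun hlt => ?_⟩
      · obtain ⟨j, hj, hne⟩ := hl.1 β hβ
        exact ⟨j, hj, by rwa [hr j (hj.trans_lt hli)]⟩
      · refine (hl.2 fun β hβ => ?_).not_gt hlt
        obtain ⟨j, hj, hne⟩ := hl' β hβ
        exact ⟨j, hj, by rwa [← hr j (hj.trans_lt (hlt.trans hli))]⟩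
    rw [val_iff_of_isLeast hl, ← hv, val_iff_of_isLeast hl']
    exact (hcol l γ γ' fun j hj => hr j (hj.trans hli)).symm
  · push Not at h
    obtain ⟨β, hβ, h⟩ := h
    -- Some β agrees with `γ'` below `i`, so `i` is exactly the splitting level.
    rw [val_iff_of_isLeast (i := i) ⟨hs, fun l hl => ?_⟩, ht']
    obtain ⟨j, hj, hne⟩ := hl β hβ
    exact le_of_not_gt fun hlt => hne (h j (hj.trans_lt hlt))

end StrongLambdaSystem

/-! ### Covering conjunctions and elements -/

namespace StrongLambdaSystem

variable {lam κ : Cardinal.{u}} (S : StrongLambdaSystem lam κ)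
  {col : S.δ.ToType → lam.ord.ToType → Prop}
  (hcol : ∀ i α β, (∀ j < i, S.f α j = S.f β j) → (col i α ↔ col i β))
  (hdense : ∀ (m : ℕ) (a : Fin m → lam.ord.ToType), Function.Injective a → ∀ t : Fin m → Prop,
      ∃ ζ i₀, ∀ i ∈ S.A ζ, i₀ ≤ i → ∀ k, col i (a k) ↔ t k)

include hcol hdense

/-- Among any `lam` many conjunctions of literals of the same type there are finitely many, each of
which is covered by the others. -/
theorem exists_covering_finset (n : ℕ) {I : Type u} {m : ℕ} (a : I → Fin m → lam.ord.ToType)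
    (ha : ∀ ξ, Function.Injective (a ξ)) (hI : lam ≤ #I) (t : Fin m → Prop) :
    ∃ W : Finset I, 1 < W.card ∧ ∀ ξ ∈ W, ∀ p : Point lam n, (∀ k, S.val col p (a ξ k) ↔ t k) →
      ∃ ξ' ∈ W, ξ' ≠ ξ ∧ ∀ k, S.val col p (a ξ' k) ↔ t k := by
  classical
  choose ζ i₀ hζ using fun ξ => hdense m (a ξ) (ha ξ) t
  have hsmall : #(κ.ord.ToType × S.δ.ToType) < lam := by
    simp only [mk_prod, lift_id, mk_ord_toType]
    exact mul_lt_of_lt S.regular.aleph0_le (S.le_card_index.trans_lt S.card_index_lt)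
      S.card_index_lt
  obtain ⟨⟨ζ₀, j₀⟩, hY⟩ := S.regular.exists_le_card_fiber (fun ξ => (ζ ξ, i₀ ξ)) hI hsmall
  set Y := (fun ξ => (ζ ξ, i₀ ξ)) ⁻¹' {(ζ₀, j₀)}
  -- At most `m * (n + 1)` members can be spoiled; the extra two are `ξ` itself and a survivor.
  obtain ⟨i, hi, hji, W, hW, hk⟩ := S.exists_fan (fun ξ : Y => a ξ) hY ζ₀ j₀ (m * (n + 1) + 2)
  have hc : ∀ ξ : Y, ∀ k, col i (a ξ k) ↔ t k := fun ξ => by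
    obtain ⟨h₁, h₂⟩ := Prod.mk.inj (show (ζ ξ, i₀ ξ) = (ζ₀, j₀) from ξ.2)
    exact hζ ξ i (h₁ ▸ hi) (h₂ ▸ hji)
  refine ⟨W.map (Function.Embedding.subtype _), by simp [hW], fun ξ hξ p hp => ?_⟩
  obtain ⟨ξ, hξW, rfl⟩ := Finset.mem_map.1 hξ
  suffices ∃ ξ' ∈ W.erase ξ, ∀ k, S.val col p (a ξ' k) ↔ t k by
    obtain ⟨ξ', hξ', h⟩ := this
    exact ⟨ξ', Finset.mem_map_of_mem _ (Finset.mem_of_mem_erase hξ'),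
      fun h => Finset.ne_of_mem_erase hξ' (Subtype.ext h), h⟩
  by_contra! hbad
  -- A member fails only at a nonconstant coordinate, where it must follow a branch of `p` up to and
  -- including level `i`.
  have hbranch : ∀ ξ' ∈ W.erase ξ, ∃ q : Fin m × lam.ord.ToType, q.2 ∈ insert p.1.1 p.1.2 ∧
      (∀ j ≤ i, S.f (a ξ' q.1) j = S.f q.2 j) ∧
      ∀ η ∈ W, ∀ η' ∈ W, η ≠ η' → S.f (a η q.1) i ≠ S.f (a η' q.1) i := by
    intro ξ' hξ'
    have hξ'W := Finset.mem_of_mem_erase hξ'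
    obtain ⟨k, hkv⟩ := hbad ξ' hξ'
    have hkv : ¬ (S.val col p (a ξ' k) ↔ t k) := by tauto
    rcases hk k with h | ⟨h, hne⟩
    · rw [← h ξ hξW ξ' hξ'W] at hkv
      exact absurd (hp k) hkv
    · by_contra! hno
      refine hkv (val_of_branch hcol (h ξ hξW ξ' hξ'W) (hc ξ' k) (fun β hβ => ?_) (hp k))
      by_contra! hβ'
      obtain ⟨η, hη, η', hη', hηη', heq⟩ := hno (k, β) (Finset.mem_insert.2 hβ) hβ'
      exact hne η hη η' hη' hηη' heq
  have : Nonempty (Fin m × lam.ord.ToType) := by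
    obtain ⟨η, hη⟩ : (W.erase ξ).Nonempty := Finset.card_pos.1 (by
      rw [Finset.card_erase_of_mem hξW]
      omega)
    exact ⟨(hbranch η hη).choose⟩
  choose! q hq using hbranch
  have hcard : (Finset.univ ×ˢ insert p.1.1 p.1.2 : Finset (Fin m × _)).card <
      (W.erase ξ).card := by
    rw [Finset.card_product, Finset.card_erase_of_mem hξW, hW, Finset.card_univ, Fintype.card_fin,
      Finset.card_insert_of_notMem p.2.1]
    have := Nat.mul_le_mul_left m (Nat.succ_le_succ p.2.2)
    simp only [Nat.succ_eq_add_one] at this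
    omega
  obtain ⟨η, hη, η', hη', hne, heq⟩ := Finset.exists_ne_map_eq_of_card_lt_of_maps_to hcard
    (f := q) fun η hη => Finset.mem_coe.2 (Finset.mem_product.2
      ⟨Finset.mem_univ _, (hq η hη).1⟩)
  refine (hq η hη).2.2 η (Finset.mem_of_mem_erase hη) η' (Finset.mem_of_mem_erase hη') hne ?_
  rw [(hq η hη).2.1 i le_rfl, heq, (hq η' hη').2.1 i le_rfl]

/-- If λ many `ξ` were uncovered, the least member of a covering set among them would be covered by
the larger ones. The strict bound on size lets one `ξ` serve all finitely many types `t`. -/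
theorem card_not_covered_lt (n : ℕ) {I : Type u} [LinearOrder I] {m : ℕ} (a : I → Fin m → lam.ord.ToType)
    (ha : ∀ ξ, Function.Injective (a ξ)) (t : Fin m → Prop) :
    #{ξ | ¬ ∃ Z : Finset I, Z.Nonempty ∧ (∀ z ∈ Z, ξ < z) ∧ ∀ p : Point lam n,
      (∀ k, S.val col p (a ξ k) ↔ t k) → ∃ z ∈ Z, ∀ k, S.val col p (a z k) ↔ t k} < lam := by
  classical
  by_contra h
  rw [not_lt] at h
  set Y := {ξ | ¬ ∃ Z : Finset I, Z.Nonempty ∧ (∀ z ∈ Z, ξ < z) ∧ ∀ p : Point lam n,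
      (∀ k, S.val col p (a ξ k) ↔ t k) → ∃ z ∈ Z, ∀ k, S.val col p (a z k) ↔ t k}
  obtain ⟨W, hW, hcov⟩ := S.exists_covering_finset hcol hdense n (fun ξ : Y => a ξ)
    (fun ξ => ha ξ) h t
  have hne : W.Nonempty := Finset.card_pos.1 (by omega)
  have hmin := W.min'_mem hne
  refine (W.min' hne).2 ⟨(W.erase (W.min' hne)).map (Function.Embedding.subtype _), ?_, ?_, ?_⟩
  · rw [Finset.map_nonempty, ← Finset.card_pos, Finset.card_erase_of_mem hmin]
    omega
  · intro z hz
    obtain ⟨z, hz', rfl⟩ := Finset.mem_map.1 hz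
    exact W.min'_lt_of_mem_erase_min' hne hz'
  · intro p hp
    obtain ⟨ξ', h₁, h₂, h₃⟩ := hcov _ hmin p hp
    exact ⟨ξ', Finset.mem_map_of_mem _ (Finset.mem_erase.2 ⟨h₂, h₁⟩), h₃⟩

/-- In any linearly ordered family of `lam` many elements of the algebra, some element is covered by
finitely many elements above it. -/
theorem exists_le_sup (n : ℕ) {I : Type u} [LinearOrder I]
    (b : I → coordAlgebra (S.val col (n := n))) (hI : lam ≤ #I) :
    ∃ ξ, ∃ Z : Finset I, Z.Nonempty ∧ (∀ z ∈ Z, ξ < z) ∧ b ξ ≤ Z.sup b := by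
  classical
  choose c a ha hca using fun ξ => exists_normal_form _ (b ξ)
  -- There are only countably many Boolean forms, and λ is uncountable.
  have hcnt : #(ULift.{u} (Σ m, Set (Fin m → Prop))) < lam := by
    refine lt_of_le_of_lt ?_ S.aleph0_lt
    exact mk_le_aleph0_iff.2 inferInstance
  obtain ⟨⟨m, Q⟩, hY⟩ := S.regular.exists_le_card_fiber (fun ξ => ULift.up (c ξ)) hI hcnt
  set Y := (fun ξ => ULift.up.{u} (c ξ)) ⁻¹' {⟨m, Q⟩}
  have hform : ∀ ξ : Y, ∃ a : Fin m → lam.ord.ToType, Function.Injective a ∧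
      ∀ p, p ∈ (b ξ).1 ↔ (fun k => S.val col p (a k)) ∈ Q := by
    rintro ⟨ξ, hξ⟩
    have hξ : c ξ = ⟨m, Q⟩ := ULift.up_injective hξ
    have h₁ := ha ξ
    have h₂ := hca ξ
    generalize a ξ = a' at h₁ h₂
    generalize c ξ = c' at hξ a' h₁ h₂
    subst hξ
    exact ⟨a', h₁, h₂⟩
  choose a ha hca using hform
  have hsmall := card_iUnion_lt_of_finite S.regular _
    fun t => S.card_not_covered_lt hcol hdense n a ha t
  obtain ⟨ξ, hξ⟩ : ∃ ξ : Y, ξ ∉ ⋃ t : Fin m → Prop, {ξ : Y | ¬ ∃ Z : Finset Y, Z.Nonempty ∧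
      (∀ z ∈ Z, ξ < z) ∧ ∀ p : Point lam n, (∀ k, S.val col p (a ξ k) ↔ t k) →
        ∃ z ∈ Z, ∀ k, S.val col p (a z k) ↔ t k} := by
    by_contra h
    rw [not_exists_not] at h
    rw [Set.eq_univ_of_forall h, mk_univ] at hsmall
    exact hsmall.not_ge hY
  simp only [Set.mem_iUnion, Set.mem_ofPred_eq, not_exists_not] at hξ
  choose Z hZ hlt hcov using hξ
  refine ⟨ξ, (Finset.univ.biUnion Z).map (Function.Embedding.subtype _), ?_, ?_, ?_⟩
  · obtain ⟨z, hz⟩ := hZ fun _ => True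
    exact ⟨z, Finset.mem_map_of_mem _ (Finset.mem_biUnion.2 ⟨_, Finset.mem_univ _, hz⟩)⟩
  · intro z hz
    obtain ⟨z, hz', rfl⟩ := Finset.mem_map.1 hz
    obtain ⟨t, -, hzt⟩ := Finset.mem_biUnion.1 hz'
    exact hlt t z hzt
  · intro p hp
    -- The type used is the actual pattern of `p` on the tuple of `ξ`; a `z` with the same pattern
    -- satisfies the common form `Q`.
    obtain ⟨z, hz, h⟩ := hcov (fun k => S.val col p (a ξ k)) p fun _ => Iff.rfl
    refine (mem_finset_sup_coordAlgebra _ _ _ p).2 ⟨z, Finset.mem_map_of_mem _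
      (Finset.mem_biUnion.2 ⟨_, Finset.mem_univ _, hz⟩), ?_⟩
    rw [hca, funext fun k => propext (h k)]
    exact (hca ξ p).1 hp

omit hcol hdense

/-- The point `(α, w)` itself is the witness. -/
theorem coordGen_not_le_sup {n : ℕ} (α : lam.ord.ToType) (w : Finset lam.ord.ToType) (hα : α ∉ w)
    (hw : w.card ≤ n) :
    ¬ coordGen (S.val col (n := n)) α ≤ w.sup (coordGen (S.val col (n := n))) := by
  intro h
  let p : Point lam n := ⟨(α, w), hα, hw⟩
  obtain ⟨β, hβ, h⟩ := (mem_finset_sup_coordAlgebra _ _ _ p).1 (h (val_self p))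
  exact not_val_of_mem p hβ h

theorem coordGen_injective {n : ℕ} (hn : 0 < n) :
    Function.Injective (coordGen (S.val col (n := n))) := by
  intro α β h
  by_contra hne
  exact S.coordGen_not_le_sup (col := col) (n := n) α {β} (by simpa using hne) (by simpa using Nat.one_le_iff_ne_zero.2 hn.ne')
    (by simp [h])

end StrongLambdaSystem

/-! ### From covering to the invariants -/

section Invariants

variable {B : Type u}

theorem succ_le_invPlus {T : Set (InvFormula B)} (P : Set B) (r : B → B → Prop)
    (h : ∀ φ ∈ T, φ P r) : succ #P ≤ invPlus B T :=
  le_csSup ⟨succ #B, by rintro _ ⟨P, r, -, rfl⟩; exact succ_le_succ (mk_set_le P)⟩ ⟨P, r, h, rfl⟩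

theorem invPlus_le_succ (T : Set (InvFormula B)) : invPlus B T ≤ succ #B :=
  csSup_le' (by rintro _ ⟨P, r, -, rfl⟩; exact succ_le_succ (mk_set_le P))

theorem invPlus_le {T : Set (InvFormula B)} {c : Cardinal.{u}}
    (h : ∀ (P : Set B) (r : B → B → Prop), c ≤ #P → ∃ φ ∈ T, ¬ φ P r) : invPlus B T ≤ c := by
  refine csSup_le' ?_
  rintro _ ⟨P, r, hT, rfl⟩
  refine succ_le_of_lt (lt_of_not_ge fun hc => ?_)
  obtain ⟨φ, hφ, hn⟩ := h P r hc
  exact hn (hT φ hφ)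

/-- An element below the join of finitely many larger elements gives an increasing sequence whose
first term is below the join of the others. -/
theorem exists_strictMono_le_sup [BooleanAlgebra B] {I : Type*} [LinearOrder I] (b : I → B) {x : I}
    {Z : Finset I} (hZ : Z.Nonempty) (hr : ∀ z ∈ Z, x < z) (hle : b x ≤ Z.sup b) :
    ∃ (k : ℕ) (y : Fin (k + 2) → I), StrictMono y ∧
      b (y 0) ≤ Finset.univ.sup fun i : Fin (k + 1) => b (y i.succ) := by
  obtain ⟨k, hk⟩ : ∃ k, Z.card = k + 1 := Nat.exists_eq_succ_of_ne_zero hZ.card_ne_zero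
  refine ⟨k, Fin.cons x (Z.orderEmbOfFin hk), ?_, hle.trans (Finset.sup_le fun z hz => ?_)⟩
  · refine Fin.strictMono_cons.2 ⟨fun i => hr _ (Z.orderEmbOfFin_mem hk i), ?_⟩
    exact (Z.orderEmbOfFin hk).strictMono
  · obtain ⟨i, rfl⟩ : z ∈ Set.range (Z.orderEmbOfFin hk) := by simpa using hz
    exact Finset.le_sup (f := fun i => b (Z.orderEmbOfFin hk i)) (Finset.mem_univ i)

end Invariants

theorem StrongLambdaSystem.exists_chain_le_sup {lam κ : Cardinal.{u}} (S : StrongLambdaSystem lam κ)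
    {col : S.δ.ToType → lam.ord.ToType → Prop}
    (hcol : ∀ i α β, (∀ j < i, S.f α j = S.f β j) → (col i α ↔ col i β))
    (hdense : ∀ (m : ℕ) (a : Fin m → lam.ord.ToType), Function.Injective a → ∀ t : Fin m → Prop,
      ∃ ζ i₀, ∀ i ∈ S.A ζ, i₀ ≤ i → ∀ k, col i (a k) ↔ t k) (n : ℕ) {I : Type u}
    (b : I → coordAlgebra (S.val col (n := n))) (hI : lam ≤ #I) (r : I → I → Prop)
    [IsStrictTotalOrder I r] :
    ∃ (k : ℕ) (y : Fin (k + 2) → I), (∀ i j, i < j → r (y i) (y j)) ∧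
      b (y 0) ≤ Finset.univ.sup fun i : Fin (k + 1) => b (y i.succ) := by
  classical
  let _ : LinearOrder I := linearOrderOfSTO r
  obtain ⟨ξ, Z, hZ, hr, hle⟩ := S.exists_le_sup hcol hdense n b hI
  obtain ⟨k, y, hy, h⟩ := exists_strictMono_le_sup b hZ hr hle
  exact ⟨k, y, fun i j hij => hy hij, h⟩

section Invariants

variable {B : Type u} [BooleanAlgebra B]

/-- A set in which no element is below the join of `n` others witnesses all three invariants. -/
theorem succ_le_of_not_le_sup {n : ℕ} (P : Set B)
    (h : ∀ x ∈ P, ∀ F : Finset B, (∀ y ∈ F, y ∈ P ∧ y ≠ x) → F.card ≤ n → ¬ x ≤ F.sup id) :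
    succ #P ≤ sPlus B n ∧ succ #P ≤ hdnPlus B n ∧ succ #P ≤ hLnPlus B n := by
  classical
  have key : ∀ k < n, ∀ x : Fin (k + 2) → B, (∀ i, x i ∈ P) → (∀ i, x (Fin.succ i) ≠ x 0) →
      ¬ x 0 ≤ Finset.univ.sup fun i : Fin (k + 1) => x i.succ := by
    intro k hk x hx hne hle
    refine h (x 0) (hx 0) (Finset.univ.image fun i : Fin (k + 1) => x i.succ) ?_ ?_ ?_
    · simpa using fun i => ⟨hx _, hne i⟩
    · exact Finset.card_image_le.trans (by simpa using hk)
    · rwa [Finset.sup_image]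
  refine ⟨succ_le_invPlus P (fun _ _ => True) ?_, succ_le_invPlus P WellOrderingRel ?_,
    succ_le_invPlus P WellOrderingRel ?_⟩
  · rintro _ ⟨k, hk, rfl⟩ x hx F hF hc
    exact h x hx F hF (hc.trans_le (Nat.cast_lt.1 hk))
  · rintro _ ⟨k, hk, rfl⟩
    refine ⟨inferInstanceAs (IsWellOrder P (Subrel WellOrderingRel (· ∈ P))), fun x hx hr => ?_⟩
    refine key k (Nat.cast_lt.1 hk) x hx fun i he => ?_
    exact irrefl (r := WellOrderingRel) (x 0) (he ▸ hr 0 i.succ (Fin.succ_pos i))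
  · rintro _ ⟨k, hk, rfl⟩
    refine ⟨inferInstanceAs (IsWellOrder P (Subrel WellOrderingRel (· ∈ P))), fun x hx hr => ?_⟩
    refine key k (Nat.cast_lt.1 hk) x hx fun i he => ?_
    exact irrefl (r := WellOrderingRel) (x 0) (he ▸ hr 0 i.succ (Fin.succ_pos i))

/-- If every strictly linearly ordered family of `c` many elements contains an increasing sequence
whose first term is below the join of the others, then the invariants for `ω` are at most `c`. -/
theorem invariants_le_of_chain {c : Cardinal.{u}}
    (h : ∀ (P : Set B) (r : P → P → Prop) [IsStrictTotalOrder P r], c ≤ #P →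
      ∃ (k : ℕ) (y : Fin (k + 2) → P), (∀ i j, i < j → r (y i) (y j)) ∧
        (y 0).1 ≤ Finset.univ.sup fun i : Fin (k + 1) => (y i.succ).1) :
    sPlus B ⊤ ≤ c ∧ hdPlus B ≤ c ∧ hLPlus B ≤ c := by
  classical
  refine ⟨invPlus_le fun P r hP => ?_, invPlus_le fun P r hP => ?_, invPlus_le fun P r hP => ?_⟩
  -- For s any strict total order will do; a chain supplies the distinctness.
  · obtain ⟨k, y, hy, hle⟩ := h P WellOrderingRel hP
    have hne : ∀ i j, i < j → y i ≠ y j := fun i j hij he =>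
      irrefl (r := WellOrderingRel) (y i) (by simpa [← he] using hy i j hij)
    have hinj : Function.Injective fun i : Fin (k + 1) => (y i.succ).1 := fun i j hij => by
      by_contra hij'
      rcases lt_or_gt_of_ne hij' with hlt | hlt
      · exact hne _ _ (Fin.succ_lt_succ_iff.2 hlt) (Subtype.ext hij)
      · exact hne _ _ (Fin.succ_lt_succ_iff.2 hlt) (Subtype.ext hij.symm)
    refine ⟨_, ⟨k, ENat.natCast_lt_top k, rfl⟩, fun hs => hs (y 0).1 (y 0).2
      (Finset.univ.image fun i : Fin (k + 1) => (y i.succ).1) ?_ ?_ ?_⟩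
    · simpa using fun i h => hne 0 i.succ (Fin.succ_pos i) (Subtype.ext h.symm)
    · rw [Finset.card_image_of_injective _ hinj, Finset.card_univ, Fintype.card_fin]
    · rwa [Finset.sup_image]
  · by_cases hwo : IsWellOrder P (fun x y => r x y)
    · obtain ⟨k, y, hy, hle⟩ := h P (fun x y => r x y) hP
      exact ⟨_, ⟨k, ENat.natCast_lt_top k, rfl⟩, fun hs => hs.2 _ (fun i => (y i).2) hy hle⟩
    · exact ⟨_, ⟨0, ENat.natCast_lt_top 0, rfl⟩, fun hs => hwo hs.1⟩
  · by_cases hwo : IsWellOrder P (fun x y => r x y)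
    -- For hL the order is reversed; the reverse need not be a well-order, but totality suffices.
    · have : IsStrictTotalOrder P (Function.swap fun x y : P => r x y) := inferInstance
      obtain ⟨k, y, hy, hle⟩ := h P (Function.swap fun x y => r x y) hP
      exact ⟨_, ⟨k, ENat.natCast_lt_top k, rfl⟩, fun hs => hs.2 _ (fun i => (y i).2) hy hle⟩
    · exact ⟨_, ⟨0, ENat.natCast_lt_top 0, rfl⟩, fun hs => hwo hs.1⟩

end Invariants

theorem mainTheorem4 (lam κ : Cardinal.{u}) (hS : Nonempty (StrongLambdaSystem lam κ))
    (n : ℕ) (hn : 0 < n) :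
    ∃ (B : Type u) (_ : BooleanAlgebra B),
      (sPlus B n = Order.succ (Cardinal.mk B) ∧ Order.succ (Cardinal.mk B) = Order.succ lam) ∧
      (hdnPlus B n = Order.succ lam ∧ hLnPlus B n = Order.succ lam) ∧
      sPlus B ⊤ ≤ lam ∧ hdPlus B ≤ lam ∧ hLPlus B ≤ lam := by
  classical
  obtain ⟨S⟩ := hS
  obtain ⟨col, hcol, hdense⟩ := S.exists_coloring
  let B := coordAlgebra (S.val col (n := n))
  have hinj := S.coordGen_injective (col := col) hn
  have : Infinite lam.ord.ToType := infinite_iff.2 (by simpa using S.regular.aleph0_le)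
  have hgen : #(Set.range (coordGen (S.val col (n := n)))) = lam := by
    rw [mk_range_eq _ hinj, mk_ord_toType]
  have hB : #B = lam := by
    refine le_antisymm ((mk_coordAlgebra_le _).trans_eq (mk_ord_toType lam)) ?_
    exact hgen.symm.le.trans (mk_set_le _)
  have hcov : ∀ x ∈ Set.range (coordGen (S.val col (n := n))), ∀ F : Finset B,
      (∀ y ∈ F, y ∈ Set.range (coordGen (S.val col (n := n))) ∧ y ≠ x) → F.card ≤ n →
        ¬ x ≤ F.sup id := by
    rintro _ ⟨α, rfl⟩ F hF hc hle
    have : Nonempty lam.ord.ToType := ⟨α⟩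
    choose! g hg using fun y hy => (hF y hy).1
    -- The set `w` consists of indices of the members of `F`.
    refine S.coordGen_not_le_sup (col := col) α (F.image g) (fun hα => ?_) (Finset.card_image_le.trans hc) ?_
    · obtain ⟨y, hy, rfl⟩ := Finset.mem_image.1 hα
      exact (hF y hy).2 (hg y hy).symm
    · rw [Finset.sup_image]
      exact hle.trans (Finset.sup_le fun y hy =>
        (hg y hy).ge.trans (Finset.le_sup (f := coordGen (S.val col (n := n)) ∘ g) hy))
  obtain ⟨h₁, h₂, h₃⟩ := succ_le_of_not_le_sup _ hcov
  rw [hgen] at h₁ h₂ h₃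
  have hB' : succ #B = succ lam := congrArg succ hB
  refine ⟨B, inferInstance, ⟨le_antisymm (invPlus_le_succ _) (hB'.trans_le h₁), hB'⟩,
    ⟨le_antisymm ((invPlus_le_succ _).trans_eq hB') h₂,
      le_antisymm ((invPlus_le_succ _).trans_eq hB') h₃⟩, ?_⟩
  exact invariants_le_of_chain fun P r _ hP =>
    S.exists_chain_le_sup hcol hdense n (fun x : P => x.1) hP r
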